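/- A coarse structure on a set $X$ is an ideal of subsets of $X\times X$ (called entourages) that contains the diagonal and is closed under $E\mapsto E^{\sf T}=\{(y,x):(x,y)\in E\}$ and under composition $E\circ F=\{(x,z):\exists y\ (x,y)\in E,\ (y,z)\in F\}$. A (finite-valued) pseudometric $d$ on $X$ induces the coarse structure $\mathcal E_d(X)=\{E\subseteq X\times X:\sup_{(x,y)\in E}d(x,y)<\infty\}$, and a coarse structure is metrisable if it equals $\mathcal E_\rho(X)$ for some metric $\rho$ on $X$. If $A\subseteq X$, the restriction $\mathcal E\upharpoonright A$ of a coarse structure $\mathcal E$ on $X$ consists of the entourages in $\mathcal E$ that are subsets of $A\times A$. For a topological group $G$, the left coarse structure is $\mathcal E_L(G)=\bigcap_d\mathcal E_d(G)$, where $d$ ranges over all continuous left-invariant pseudometrics on $G$. Let $H$ be a closed normal subgroup of $G$ with quotient map $\pi\colon G\to G/H$. The quotient coarse structure $\mathcal E_q(G/H)$ is the smallest coarse structure on $G/H$ containing $(\pi\times\pi)[E]$ for every $E\in\mathcal E_L(G)$. The Hausdorff-distance coarse structure is $\mathcal E_{\rm Haus}(G/H)=\bigcap_d\mathcal E_{d_{\rm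 Haus}}(G/H)$, where $d$ again ranges over all continuous left-invariant pseudometrics on $G$ and $d_{\rm Haus}$ is the pseudometric on $G/H$ given by the $d$-Hausdorff distance between cosets, $$d_{\rm Haus}(Hg,Hf)=\max\Big\{\sup_{h\in H}\inf_{k\in H}d(hg,kf),\ \sup_{k\in H}\inf_{h\in H}d(hg,kf)\Big\}.$$ Finally, $\mathcal E_L(G/H)$ is the left coarse structure of the topological quotient group $G/H$. Theorem. Let $G=\prod_{n=1}^\infty G_n$ be the product, with the product topology, of a sequence of locally compact, $\sigma$-compact topological groups $G_n$, and let $H$ be a closed normal subgroup of $G$. If $\mathcal E_L(G)\upharpoonright H$ is metrisable, then $$\mathcal E_q(G/H)=\mathcal E_L(G/H)=\mathcal E_{\rm Haus}(G/H).$$ -/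

import Mathlib

/-- A coarse structure on `X` (in the sense of Roe): an ideal of subsets of `X × X`, called
entourages, containing the diagonal and closed under transposition and composition. -/
@[ext]
structure CoarseStructure (X : Type*) where
  entourages : Set (Set (X × X))
  mem_of_subset : ∀ E ∈ entourages, ∀ F ⊆ E, F ∈ entourages
  union_mem : ∀ E ∈ entourages, ∀ F ∈ entourages, E ∪ F ∈ entourages
  diagonal_mem : Set.diagonal X ∈ entourages
  transpose_mem : ∀ E ∈ entourages, {p : X × X | (p.2, p.1) ∈ E} ∈ entourages
  comp_mem : ∀ E ∈ entourages, ∀ F ∈ entourages,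
    {p : X × X | ∃ y, (p.1, y) ∈ E ∧ (y, p.2) ∈ F} ∈ entourages

namespace CoarseStructure

/-- The intersection of a family of coarse structures; the intersection of the empty family is
the coarse structure of all subsets of `X × X`. -/
instance {X : Type*} : InfSet (CoarseStructure X) where
  sInf S :=
    { entourages := {E | ∀ 𝓔 ∈ S, E ∈ 𝓔.entourages}
      mem_of_subset := fun E hE F hF 𝓔 h => 𝓔.mem_of_subset E (hE 𝓔 h) F hF
      union_mem := fun E hE F hF 𝓔 h => 𝓔.union_mem E (hE 𝓔 h) F (hF 𝓔 h)
      diagonal_mem := fun 𝓔 _ => 𝓔.diagonal_mem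
      transpose_mem := fun E hE 𝓔 h => 𝓔.transpose_mem E (hE 𝓔 h)
      comp_mem := fun E hE F hF 𝓔 h => 𝓔.comp_mem E (hE 𝓔 h) F (hF 𝓔 h) }

/-- A map between coarse spaces is controlled if it sends entourages to entourages. -/
def Controlled {X Y : Type*} (𝓔 : CoarseStructure X) (𝓕 : CoarseStructure Y) (φ : X → Y) : Prop :=
  ∀ E ∈ 𝓔.entourages, Prod.map φ φ '' E ∈ 𝓕.entourages

/-- The quotient coarse structure along a (quotient) map `π`: the smallest coarse structure on
the target for which `π` is controlled. -/
def quotient {X Y : Type*} (𝓔 : CoarseStructure X) (π : X → Y) : CoarseStructure Y :=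
  sInf {𝓕 | Controlled 𝓔 𝓕 π}

/-- The restriction of a coarse structure on `X` to a subset `A` of `X`. -/
def restrict {X : Type*} (𝓔 : CoarseStructure X) (A : Set X) : CoarseStructure A where
  entourages := {E | Prod.map Subtype.val Subtype.val '' E ∈ 𝓔.entourages}
  mem_of_subset := fun _ hE _ hF => 𝓔.mem_of_subset _ hE _ (Set.image_mono hF)
  union_mem := fun E hE F hF => by
    simpa only [Set.mem_setOf_eq, Set.image_union] using 𝓔.union_mem _ hE _ hF
  diagonal_mem := by
    refine 𝓔.mem_of_subset _ 𝓔.diagonal_mem _ ?_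
    rintro _ ⟨⟨x, y⟩, h, rfl⟩
    exact congrArg Subtype.val h
  transpose_mem := fun E hE => by
    refine 𝓔.mem_of_subset _ (𝓔.transpose_mem _ hE) _ ?_
    rintro _ ⟨⟨x, y⟩, h, rfl⟩
    exact ⟨(y, x), h, rfl⟩
  comp_mem := fun E hE F hF => by
    refine 𝓔.mem_of_subset _ (𝓔.comp_mem _ hE _ hF) _ ?_
    rintro _ ⟨⟨x, z⟩, ⟨y, h₁, h₂⟩, rfl⟩
    exact ⟨y, ⟨(x, y), h₁, rfl⟩, ⟨(y, z), h₂, rfl⟩⟩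

/-- The coarse structure induced by a real-valued pseudometric `d`: its entourages are the sets
on which `d` is bounded. -/
def ofPseudoMetric {X : Type*} (d : PseudoMetric X ℝ) : CoarseStructure X where
  entourages := {E | ∃ C : ℝ, ∀ p ∈ E, d p.1 p.2 ≤ C}
  mem_of_subset := fun _ ⟨C, hC⟩ _ hF => ⟨C, fun p hp => hC p (hF hp)⟩
  union_mem := fun _ ⟨C, hC⟩ _ ⟨D, hD⟩ => ⟨max C D, fun p hp => hp.elim
    (fun h => (hC p h).trans (le_max_left _ _)) (fun h => (hD p h).trans (le_max_right _ _))⟩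
  diagonal_mem := ⟨0, by
    rintro ⟨x, y⟩ h
    obtain rfl : x = y := h
    exact (d.refl x).le⟩
  transpose_mem := fun _ ⟨C, hC⟩ => ⟨C, fun p hp => (d.symm _ _).le.trans (hC _ hp)⟩
  comp_mem := fun _ ⟨C, hC⟩ _ ⟨D, hD⟩ => ⟨C + D, fun p ⟨y, h₁, h₂⟩ =>
    (d.triangle p.1 y p.2).trans (add_le_add (hC _ h₁) (hD _ h₂))⟩

/-- A coarse structure is metrisable if it is induced by a metric. -/
def Metrisable {X : Type*} (𝓔 : CoarseStructure X) : Prop :=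
  ∃ ρ : PseudoMetric X ℝ, (∀ x y, ρ x y = 0 → x = y) ∧ 𝓔 = ofPseudoMetric ρ

end CoarseStructure

/-- `d` is a left-invariant pseudometric on the group `G`. -/
def IsLeftInvariantPseudometric {G : Type*} [Group G] (d : PseudoMetric G ℝ) : Prop :=
  ∀ h g f : G, d (h * g) (h * f) = d g f

/-- `d` is a continuous left-invariant pseudometric on the topological group `G`. -/
structure IsContinuousLeftInvariant {G : Type*} [Group G] [TopologicalSpace G]
    (d : PseudoMetric G ℝ) : Prop where
  continuous : Continuous fun p : G × G => d p.1 p.2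
  leftInvariant : IsLeftInvariantPseudometric d

/-- The left coarse structure `𝓔_L(G)` of a topological group: the intersection of the coarse
structures induced by all continuous left-invariant pseudometrics. -/
def leftCoarse (G : Type*) [Group G] [TopologicalSpace G] : CoarseStructure G :=
  ⨅ d : {d : PseudoMetric G ℝ // IsContinuousLeftInvariant d}, CoarseStructure.ofPseudoMetric d.1

/-- The pseudometric space structure given by a bundled pseudometric. It is only used to speak of
the Hausdorff distance; it is unrelated to any topology that `X` may carry. -/
abbrev PseudoMetric.toSpace {X : Type*} (d : PseudoMetric X ℝ) : PseudoMetricSpace X where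
  dist x y := d x y
  dist_self := d.refl
  dist_comm := d.symm
  dist_triangle := d.triangle

/-- The `d`-Hausdorff distance between two cosets `a`, `b` of a normal subgroup `H`, seen as subsets
of `G` (the fibres of the quotient map over `a` and `b`, i.e. `gH = Hg` for `g` in `a`). -/
noncomputable def cosetHausdorffDist {G : Type*} [Group G] (d : PseudoMetric G ℝ)
    (H : Subgroup G) (a b : G ⧸ H) : ℝ :=
  letI : PseudoMetricSpace G := d.toSpace
  Metric.hausdorffDist ((QuotientGroup.mk : G → G ⧸ H) ⁻¹' {a})
    ((QuotientGroup.mk : G → G ⧸ H) ⁻¹' {b})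

/-- The Hausdorff distance between cosets of a normal subgroup is finite, so the value of
`cosetHausdorffDist` is never a default value. -/
theorem coset_hausdorffEDist_ne_top {G : Type*} [Group G] (d : PseudoMetric G ℝ)
    (hd : IsLeftInvariantPseudometric d) (H : Subgroup G) [hH : H.Normal] (a b : G ⧸ H) :
    letI : PseudoMetricSpace G := d.toSpace
    Metric.hausdorffEDist ((QuotientGroup.mk : G → G ⧸ H) ⁻¹' {a})
      ((QuotientGroup.mk : G → G ⧸ H) ⁻¹' {b}) ≠ ⊤ := by
  letI : PseudoMetricSpace G := d.toSpace
  obtain ⟨g, rfl⟩ := QuotientGroup.mk_surjective a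
  obtain ⟨f, rfl⟩ := QuotientGroup.mk_surjective b
  have key : ∀ g f x : G, (x : G ⧸ H) = g →
      ∃ y : G, (y : G ⧸ H) = f ∧ edist x y ≤ edist g f := by
    intro g f x hx
    refine ⟨x * g⁻¹ * f, ?_, ?_⟩
    · rw [QuotientGroup.mk_mul, QuotientGroup.mk_mul, hx, QuotientGroup.mk_inv]
      simp
    · have h : dist x (x * g⁻¹ * f) = dist g f := by
        have := hd (x * g⁻¹) g f
        rw [inv_mul_cancel_right] at this
        exact this
      rw [edist_dist, edist_dist, h]
  refine ne_top_of_le_ne_top (edist_ne_top g f) ?_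
  refine Metric.hausdorffEDist_le_of_mem_edist (fun x hx => ?_) (fun x hx => ?_)
  · exact key g f x hx
  · obtain ⟨y, hy, h⟩ := key f g x hx
    exact ⟨y, hy, h.trans (edist_comm f g).le⟩

/-- The pseudometric `d_Haus` on `G ⧸ H` (for `H` normal) induced by a left-invariant pseudometric
`d` on `G`: the `d`-Hausdorff distance between cosets. -/
noncomputable def hausdorffPseudometric {G : Type*} [Group G] (d : PseudoMetric G ℝ)
    (hd : IsLeftInvariantPseudometric d) (H : Subgroup G) [H.Normal] :
    PseudoMetric (G ⧸ H) ℝ where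
  toFun := cosetHausdorffDist d H
  refl' _ := by
    letI : PseudoMetricSpace G := d.toSpace
    exact Metric.hausdorffDist_self_zero
  symm' _ _ := by
    letI : PseudoMetricSpace G := d.toSpace
    exact Metric.hausdorffDist_comm
  triangle' a b _ := by
    letI : PseudoMetricSpace G := d.toSpace
    exact Metric.hausdorffDist_triangle (coset_hausdorffEDist_ne_top d hd H a b)

/-- The Hausdorff-distance coarse structure `𝓔_Haus(G/H)`: the intersection of the coarse
structures induced by `d_Haus`, for `d` a continuous left-invariant pseudometric on `G`. -/
noncomputable def hausdorffCoarse {G : Type*} [Group G] [TopologicalSpace G] (H : Subgroup G)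
    [H.Normal] : CoarseStructure (G ⧸ H) :=
  ⨅ d : {d : PseudoMetric G ℝ // IsContinuousLeftInvariant d},
    CoarseStructure.ofPseudoMetric (hausdorffPseudometric d.1 d.2.leftInvariant H)

/-! ### Left-invariant pseudometrics from scales of neighbourhoods -/

section

open Set Filter Topology Pointwise NNReal

/-! A left coarse structure is determined by its coarsely bounded sets: `E` is an entourage iff the
elements `x⁻¹ * y`, for `(x, y) ∈ E`, form such a set (`mem_leftCoarse_iff`).

The second equality holds for every normal subgroup: `d_Haus` is continuous and left-invariant on
the quotient, and a pseudometric on the quotient is dominated by the Hausdorff pseudometric of its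
pullback. The first follows once coarsely bounded sets of cosets lift to coarsely bounded sets
(`CoarselyBounded.exists_lift`).

Proper pseudometrics on the factors show that in the product, coarsely bounded means that each
coordinate stays in a compact set. Metrisability on `H` then yields, by a diagonal argument, an `N`
such that compactness of the first `N` coordinates controls all coordinates of elements of `H`.
Hence it suffices to choose representatives whose first `N` coordinates are compactly confined:
compact lifts to more coordinates differ from these by elements of `H` already under control. -/

theorem PseudoMetric.isContinuousLeftInvariant_of_eventually {L : Type*} [Group L]
    [TopologicalSpace L] [IsTopologicalGroup L] (d : PseudoMetric L ℝ)
    (hd : IsLeftInvariantPseudometric d) (h : ∀ ε > 0, ∀ᶠ x in 𝓝 (1 : L), d 1 x < ε) :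
    IsContinuousLeftInvariant d := by
  refine ⟨continuous_iff_continuousAt.2 fun p => ?_, hd⟩
  have key : ∀ a : L, Tendsto (fun x => d a x) (𝓝 a) (𝓝 0) := by
    intro a
    have h1 : Tendsto (fun x => d 1 x) (𝓝 1) (𝓝 0) := by
      refine Metric.tendsto_nhds.2 fun ε hε => (h ε hε).mono fun x hx => ?_
      rwa [Real.dist_0_eq_abs, abs_of_nonneg (d.nonneg 1 x)]
    have h2 : Tendsto (fun x => a⁻¹ * x) (𝓝 a) (𝓝 1) := by
      have : ContinuousAt (fun x => a⁻¹ * x) a := by fun_prop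
      simpa [ContinuousAt] using this
    refine (h1.comp h2).congr fun x => ?_
    simpa using (hd a⁻¹ a x).symm ▸ (congrArg (fun y => d y (a⁻¹ * x)) (inv_mul_cancel a)).symm
  have hsum : Tendsto (fun q : L × L => d p.1 q.1 + d p.2 q.2) (𝓝 p) (𝓝 0) := by
    have h1 := (key p.1).comp (continuous_fst.tendsto p)
    have h2 := (key p.2).comp (continuous_snd.tendsto p)
    simpa using h1.add h2
  refine tendsto_iff_dist_tendsto_zero.2 (squeeze_zero (fun _ => dist_nonneg) (fun q => ?_) hsum)
  rw [Real.dist_eq, abs_le]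
  have e1 := d.triangle p.1 q.1 p.2
  have e2 := d.triangle q.1 q.2 p.2
  have e3 := d.triangle q.1 p.1 q.2
  have e4 := d.triangle p.1 p.2 q.2
  have e5 := d.symm p.1 q.1
  have e6 := d.symm p.2 q.2
  constructor <;> linarith

/-- A two-sided scale of identity neighbourhoods determines a continuous left-invariant
pseudometric whose balls are controlled by the scale. -/
theorem exists_pseudometric_of_scale {L : Type*} [Group L] [TopologicalSpace L]
    [IsTopologicalGroup L] (V : ℤ → Set L) (hnhds : ∀ n, V n ∈ 𝓝 (1 : L))
    (hinv : ∀ n, ∀ x ∈ V n, x⁻¹ ∈ V n)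
    (hmul : ∀ n, ∀ x ∈ V n, ∀ y ∈ V n, ∀ z ∈ V n, x * y * z ∈ V (n + 1))
    (hcov : ∀ x, ∃ n, x ∈ V n) :
    ∃ d : PseudoMetric L ℝ, IsContinuousLeftInvariant d ∧
      ∀ (n : ℤ) (x : L), d 1 x < 2 ^ n → x ∈ V n := by
  have hone : ∀ n, (1 : L) ∈ V n := fun n => mem_of_mem_nhds (hnhds n)
  have hmono : Monotone V := monotone_int_of_le_succ fun n x hx => by
    simpa using hmul n x hx 1 (hone n) 1 (hone n)
  -- Birkhoff–Kakutani gauge. The triple-product condition gives `N (x * y * z) ≤ 2 * max`, which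
  -- makes the chain pseudometric comparable to `N` up to a factor 2.
  let N : L → ℝ≥0 := fun x => sInf {r | ∃ n : ℤ, x ∈ V n ∧ r = 2 ^ n}
  have hN_le : ∀ {x n}, x ∈ V n → N x ≤ 2 ^ n := fun {x n} hx =>
    csInf_le (OrderBot.bddBelow _) ⟨n, hx, rfl⟩
  -- The infimum is over powers of 2, so a bound below `2 ^ (n + 1)` already forces level `n`; this
  -- gain absorbs the factor 2 lost to chains.
  have hN_lt : ∀ {x} {n : ℤ}, N x < 2 ^ (n + 1) → x ∈ V n := by
    intro x n h
    obtain ⟨k, hk⟩ := hcov x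
    obtain ⟨_, ⟨m, hm, rfl⟩, hlt⟩ := exists_lt_of_csInf_lt (by exact ⟨_, k, hk, rfl⟩) h
    have : m < n + 1 := (zpow_lt_zpow_iff_right₀ (by norm_num)).1 hlt
    exact hmono (by omega) hm
  have hN_one : N 1 = 0 := by
    by_contra h
    obtain ⟨n, hn, -⟩ := NNReal.exists_mem_Ioc_zpow h (y := 2) (by norm_num)
    exact (hN_le (hone n)).not_gt hn
  have hN_inv : ∀ x, N x⁻¹ = N x := by
    intro x
    have : ∀ n, x⁻¹ ∈ V n ↔ x ∈ V n := fun n =>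
      ⟨fun h => by simpa using hinv n _ h, hinv n x⟩
    simp only [N, this]
  have hN_mul : ∀ x y z, N (x * y * z) ≤ 2 * max (N x) (max (N y) (N z)) := by
    intro x y z
    by_contra! h
    obtain ⟨n, hn, hn'⟩ := NNReal.exists_mem_Ioc_zpow (bot_lt_of_lt h).ne' (y := 2) (by norm_num)
    have hlt : max (N x) (max (N y) (N z)) < 2 ^ n := by
      rw [zpow_add_one₀ (by norm_num), mul_comm] at hn'
      exact lt_of_mul_lt_mul_left (h.trans_le hn') zero_le
    have hmem : ∀ w, N w < 2 ^ n → w ∈ V (n - 1) := fun w hw => hN_lt (by simpa using hw)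
    simp only [max_lt_iff] at hlt
    have := hmul (n - 1) x (hmem x hlt.1) y (hmem y hlt.2.1) z (hmem z hlt.2.2)
    rw [sub_add_cancel] at this
    exact (hN_le this).not_gt hn
  let e : L → L → ℝ≥0 := fun x y => N (x⁻¹ * y)
  have e_self : ∀ x, e x x = 0 := fun x => by simp [e, hN_one]
  have e_comm : ∀ x y, e x y = e y x := fun x y => by
    simpa [e] using hN_inv (y⁻¹ * x)
  let I := PseudoMetricSpace.ofPreNNDist e e_self e_comm
  have I_le : ∀ x y, dist x y ≤ e x y := PseudoMetricSpace.dist_ofPreNNDist_le e e_self e_comm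
  have le_I : ∀ x y, (e x y : ℝ) ≤ 2 * dist x y := by
    refine PseudoMetricSpace.le_two_mul_dist_ofPreNNDist e e_self e_comm fun a b c f => ?_
    simpa [e, mul_assoc] using hN_mul (a⁻¹ * b) (b⁻¹ * c) (c⁻¹ * f)
  let d : PseudoMetric L ℝ :=
    { toFun := fun x y => dist x y
      refl' := dist_self
      symm' := dist_comm
      triangle' := dist_triangle }
  have d_left_le : ∀ h g f : L, dist (h * g) (h * f) ≤ dist g f := by
    intro h g f
    rw [PseudoMetricSpace.dist_ofPreNNDist, PseudoMetricSpace.dist_ofPreNNDist, NNReal.coe_le_coe]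
    -- Translating a chain from `g` to `f` by `h` gives a chain from `h * g` to `h * f` of the same
    -- total length.
    refine le_ciInf fun l => (ciInf_le (OrderBot.bddBelow _) (l.map (h * ·))).trans_eq ?_
    have h1 : (h * g :: l.map (h * ·)) = (g :: l).map (h * ·) := rfl
    have h2 : (l.map (h * ·) ++ [h * f]) = (l ++ [f]).map (h * ·) := by simp
    rw [h1, h2, List.zipWith_map]
    simp [e, mul_assoc]
  have d_left : IsLeftInvariantPseudometric d := by
    intro h g f
    refine (d_left_le h g f).antisymm ?_
    simpa using d_left_le h⁻¹ (h * g) (h * f)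
  refine ⟨d, d.isContinuousLeftInvariant_of_eventually d_left fun ε hε => ?_, fun n x hx => ?_⟩
  · obtain ⟨n, hn, -⟩ := exists_mem_Ioc_zpow hε (y := (2 : ℝ)) (by norm_num)
    filter_upwards [hnhds n] with x hx
    refine lt_of_le_of_lt ((I_le 1 x).trans ?_) hn
    have := hN_le hx
    simpa [e] using (NNReal.coe_le_coe.2 this)
  · refine hN_lt ?_
    have h1 := le_I 1 x
    have h2 : dist 1 x < (2 : ℝ) ^ n := hx
    rw [← NNReal.coe_lt_coe]
    simp only [e, inv_one, one_mul] at h1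
    push_cast
    rw [zpow_add_one₀ (by norm_num)]
    linarith

/-- A locally compact, `σ`-compact group admits a proper continuous left-invariant
pseudometric. -/
theorem exists_proper_pseudometric (L : Type*) [Group L] [TopologicalSpace L]
    [IsTopologicalGroup L] [LocallyCompactSpace L] [SigmaCompactSpace L] :
    ∃ d : PseudoMetric L ℝ, IsContinuousLeftInvariant d ∧
      ∀ C : ℝ, ∃ K : Set L, IsCompact K ∧ ∀ x, d 1 x ≤ C → x ∈ K := by
  obtain ⟨K₀, hK₀, hK₀n⟩ := exists_compact_mem_nhds (1 : L)
  -- The nonnegative levels are compact and exhaust `L`, which makes the pseudometric proper.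
  let A : ℕ → Set L := fun n => Nat.rec (K₀ ∪ K₀⁻¹)
    (fun n S => S * S * S ∪ (compactCovering L n ∪ (compactCovering L n)⁻¹)) n
  have A_zero : A 0 = K₀ ∪ K₀⁻¹ := rfl
  have A_succ : ∀ n, A (n + 1) =
    A n * A n * A n ∪ (compactCovering L n ∪ (compactCovering L n)⁻¹) := fun n => rfl
  have A_compact : ∀ n, IsCompact (A n) := by
    intro n
    induction n with
    | zero => exact hK₀.union hK₀.inv
    | succ n ih =>
      rw [A_succ]
      exact ((ih.mul ih).mul ih).union
        ((isCompact_compactCovering L n).union (isCompact_compactCovering L n).inv)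
  have A_mul : ∀ n, ∀ x ∈ A n, ∀ y ∈ A n, ∀ z ∈ A n, x * y * z ∈ A (n + 1) :=
    fun n x hx y hy z hz => Or.inl (mul_mem_mul (mul_mem_mul hx hy) hz)
  have A_nhds : ∀ n, A n ∈ 𝓝 (1 : L) := by
    intro n
    induction n with
    | zero => exact mem_of_superset hK₀n subset_union_left
    | succ n ih =>
      refine mem_of_superset ih fun x hx => ?_
      simpa using A_mul n x hx 1 (mem_of_mem_nhds ih) 1 (mem_of_mem_nhds ih)
  have A_inv : ∀ n, ∀ x ∈ A n, x⁻¹ ∈ A n := by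
    intro n
    induction n with
    | zero =>
      rintro x (hx | hx)
      · exact Or.inr (by simpa using hx)
      · exact Or.inl hx
    | succ n ih =>
      rintro x (hx | hx | hx)
      · obtain ⟨_, ⟨a, ha, b, hb, rfl⟩, c, hc, rfl⟩ := hx
        simpa [mul_assoc] using A_mul n _ (ih c hc) _ (ih b hb) _ (ih a ha)
      · exact Or.inr (Or.inr (by simpa using hx))
      · exact Or.inr (Or.inl hx)
  have step : ∀ U : Set L, U ∈ 𝓝 1 → ∃ W : Set L, W ∈ 𝓝 1 ∧ (∀ x ∈ W, x⁻¹ ∈ W) ∧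
      ∀ x ∈ W, ∀ y ∈ W, ∀ z ∈ W, x * y * z ∈ U := by
    intro U hU
    obtain ⟨W, hW, hWU⟩ := exists_nhds_one_split4 hU
    refine ⟨W ∩ W⁻¹, inter_mem hW (inv_mem_nhds_one L hW), fun x hx => ⟨hx.2, by simpa using hx.1⟩,
      fun x hx y hy z hz => ?_⟩
    simpa using hWU hx.1 hy.1 hz.1 (mem_of_mem_nhds hW)
  choose! f f_nhds f_inv f_mul using step
  -- `B n` sits at level `-(n + 1)`, hence the `n + 1` iterations starting from level 0.
  let B : ℕ → Set L := fun n => f^[n + 1] (A 0)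
  have B_nhds' : ∀ n, f^[n] (A 0) ∈ 𝓝 (1 : L) := by
    intro n
    induction n with
    | zero => exact A_nhds 0
    | succ n ih =>
      rw [Function.iterate_succ_apply']
      exact f_nhds _ ih
  have B_eq : ∀ n, B n = f (f^[n] (A 0)) := fun n => Function.iterate_succ_apply' f n (A 0)
  obtain ⟨d, hd, hdV⟩ := exists_pseudometric_of_scale
    (fun n : ℤ => match n with
      | Int.ofNat n => A n
      | Int.negSucc n => B n)
    (by rintro (n | n); exacts [A_nhds n, B_nhds' (n + 1)])
    (by rintro (n | n); exacts [A_inv n, by simpa only [B_eq] using f_inv _ (B_nhds' n)])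
    (by
      rintro (n | _ | n)
      · exact A_mul n
      · exact f_mul _ (A_nhds 0)
      · have := f_mul _ (B_nhds' (n + 1))
        rw [← B_eq] at this
        exact this)
    (fun x => by
      obtain ⟨n, hn⟩ := mem_iUnion.1 ((iUnion_compactCovering L).symm ▸ mem_univ x :
        x ∈ ⋃ n, compactCovering L n)
      exact ⟨(n + 1 : ℕ), Or.inr (Or.inl hn)⟩)
  refine ⟨d, hd, fun C => ?_⟩
  obtain ⟨n, hn⟩ := pow_unbounded_of_one_lt C (one_lt_two)
  exact ⟨A n, A_compact n, fun x hx => hdV (n : ℤ) x (by rw [zpow_natCast]; exact hx.trans_lt hn)⟩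

end

/-! ### Coarsely bounded sets and the left coarse structure -/

section

open Set Filter Topology Pointwise

/-- The pullback of a pseudometric along a map. -/
def PseudoMetric.comap {X Y : Type*} (f : X → Y) (d : PseudoMetric Y ℝ) : PseudoMetric X ℝ where
  toFun x y := d (f x) (f y)
  refl' _ := d.refl _
  symm' _ _ := d.symm _ _
  triangle' _ _ _ := d.triangle _ _ _

@[simp]
theorem PseudoMetric.comap_apply {X Y : Type*} (f : X → Y) (d : PseudoMetric Y ℝ) (x y : X) :
    d.comap f x y = d (f x) (f y) := rfl

theorem IsContinuousLeftInvariant.continuous_one {G : Type*} [Group G] [TopologicalSpace G]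
    {d : PseudoMetric G ℝ} (hd : IsContinuousLeftInvariant d) : Continuous fun x => d 1 x :=
  hd.continuous.comp (continuous_const.prodMk continuous_id)

theorem IsContinuousLeftInvariant.comap {G L : Type*} [Group G] [TopologicalSpace G] [Group L]
    [TopologicalSpace L] {d : PseudoMetric L ℝ} (hd : IsContinuousLeftInvariant d) (f : G →* L)
    (hf : Continuous f) : IsContinuousLeftInvariant (d.comap f) where
  continuous := hd.continuous.comp (hf.prodMap hf)
  leftInvariant h g k := by simpa using hd.leftInvariant (f h) (f g) (f k)

/-- A subset of a topological group is coarsely bounded if it has finite diameter for every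
continuous left-invariant pseudometric. -/
def CoarselyBounded {G : Type*} [Group G] [TopologicalSpace G] (A : Set G) : Prop :=
  ∀ d : PseudoMetric G ℝ, IsContinuousLeftInvariant d → ∃ C : ℝ, ∀ x ∈ A, d 1 x ≤ C

theorem IsCompact.coarselyBounded {G : Type*} [Group G] [TopologicalSpace G] {K : Set G}
    (hK : IsCompact K) : CoarselyBounded K := by
  intro d hd
  obtain ⟨C, hC⟩ := hK.bddAbove_image hd.continuous_one.continuousOn
  exact ⟨C, fun x hx => hC (mem_image_of_mem _ hx)⟩

theorem CoarselyBounded.mono {G : Type*} [Group G] [TopologicalSpace G] {A B : Set G}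
    (hB : CoarselyBounded B) (h : A ⊆ B) : CoarselyBounded A := fun d hd =>
  (hB d hd).imp fun _ hC x hx => hC x (h hx)

theorem CoarselyBounded.image {G L : Type*} [Group G] [TopologicalSpace G] [Group L]
    [TopologicalSpace L] {A : Set G} (hA : CoarselyBounded A) (f : G →* L) (hf : Continuous f) :
    CoarselyBounded (f '' A) := by
  intro d hd
  obtain ⟨C, hC⟩ := hA _ (hd.comap f hf)
  refine ⟨C, ?_⟩
  rintro _ ⟨x, hx, rfl⟩
  simpa using hC x hx

theorem CoarselyBounded.exists_isCompact {G : Type*} [Group G] [TopologicalSpace G]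
    [IsTopologicalGroup G] [LocallyCompactSpace G] [SigmaCompactSpace G] {A : Set G}
    (hA : CoarselyBounded A) : ∃ K, IsCompact K ∧ A ⊆ K := by
  obtain ⟨d, hd, hK⟩ := exists_proper_pseudometric G
  obtain ⟨C, hC⟩ := hA d hd
  obtain ⟨K, hK, h⟩ := hK C
  exact ⟨K, hK, fun x hx => h x (hC x hx)⟩

/-- In a product of locally compact, `σ`-compact groups, a set is coarsely bounded if and only if
all its coordinates lie in compact sets. -/
theorem coarselyBounded_pi_iff {ι : Type*} {G : ι → Type*} [∀ i, Group (G i)]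
    [∀ i, TopologicalSpace (G i)] [∀ i, IsTopologicalGroup (G i)]
    [∀ i, LocallyCompactSpace (G i)] [∀ i, SigmaCompactSpace (G i)] {A : Set (∀ i, G i)} :
    CoarselyBounded A ↔ ∀ i, ∃ K : Set (G i), IsCompact K ∧ ∀ x ∈ A, x i ∈ K := by
  constructor
  · intro hA i
    obtain ⟨K, hK, h⟩ := (hA.image (Pi.evalMonoidHom G i) (continuous_apply i)).exists_isCompact
    exact ⟨K, hK, fun x hx => h (mem_image_of_mem _ hx)⟩
  · intro h
    choose K hK hAK using h
    exact (isCompact_univ_pi hK).coarselyBounded.mono fun x hx i _ => hAK i x hx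

theorem mem_entourages_iInf_iff {ι X : Type*} {𝓔 : ι → CoarseStructure X} {E : Set (X × X)} :
    E ∈ (⨅ i, 𝓔 i).entourages ↔ ∀ i, E ∈ (𝓔 i).entourages :=
  forall_mem_range

theorem mem_leftCoarse_iff {G : Type*} [Group G] [TopologicalSpace G] {E : Set (G × G)} :
    E ∈ (leftCoarse G).entourages ↔ CoarselyBounded ((fun p : G × G => p.1⁻¹ * p.2) '' E) := by
  refine mem_entourages_iInf_iff.trans (Subtype.forall.trans (forall₂_congr fun d hd => ?_))
  refine exists_congr fun C => ?_
  rw [forall_mem_image]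
  refine forall₂_congr fun p _ => ?_
  rw [← hd.leftInvariant p.1⁻¹ p.1 p.2, inv_mul_cancel]

/-! ### Hausdorff pseudometrics and quotient groups -/

section Hausdorff

variable {G : Type*} [Group G] (H : Subgroup G) [H.Normal]

/-- For `x` in the coset of `g`, left translation by `x * g⁻¹` is isometric, takes `g` to `x` and,
by normality, keeps `f` in its coset. -/
theorem hausdorffPseudometric_mk_le (d : PseudoMetric G ℝ) (hd : IsLeftInvariantPseudometric d)
    (g f : G) : hausdorffPseudometric d hd H (g : G ⧸ H) (f : G ⧸ H) ≤ d g f := by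
  let _ : PseudoMetricSpace G := d.toSpace
  have key : ∀ g f x : G, (x : G ⧸ H) = g → ∃ y : G, (y : G ⧸ H) = f ∧ d x y = d g f := by
    intro g f x hx
    refine ⟨x * g⁻¹ * f, ?_, ?_⟩
    · rw [QuotientGroup.mk_mul, QuotientGroup.mk_mul, hx, QuotientGroup.mk_inv]
      simp
    · simpa using hd (x * g⁻¹) g f
  refine Metric.hausdorffDist_le_of_mem_dist (d.nonneg g f) (fun x hx => ?_) (fun x hx => ?_)
  · obtain ⟨y, hy, h⟩ := key g f x hx
    exact ⟨y, hy, h.le⟩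
  · obtain ⟨y, hy, h⟩ := key f g x hx
    exact ⟨y, hy, (h.trans (d.symm f g)).le⟩

theorem hausdorffPseudometric_leftInvariant (d : PseudoMetric G ℝ)
    (hd : IsLeftInvariantPseudometric d) :
    IsLeftInvariantPseudometric (hausdorffPseudometric d hd H) := by
  let _ : PseudoMetricSpace G := d.toSpace
  intro a b c
  obtain ⟨h, rfl⟩ := QuotientGroup.mk_surjective a
  have iso : Isometry fun x : G => h * x := Isometry.of_dist_eq fun x y => hd h x y
  have him : ∀ b : G ⧸ H, (QuotientGroup.mk : G → G ⧸ H) ⁻¹' {(h : G ⧸ H) * b} =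
      (fun x : G => h * x) '' ((QuotientGroup.mk : G → G ⧸ H) ⁻¹' {b}) := by
    intro b
    ext x
    simpa using (inv_mul_eq_iff_eq_mul (a := (h : G ⧸ H)) (b := x)).symm
  change Metric.hausdorffDist _ _ = Metric.hausdorffDist _ _
  rw [him, him, Metric.hausdorffDist_image iso]

/-- The pullback is constant on fibres, so all points over `b` are equally far from a given point
over `a`. -/
theorem le_hausdorffPseudometric_comap (d : PseudoMetric (G ⧸ H) ℝ)
    (hd : IsLeftInvariantPseudometric (d.comap (QuotientGroup.mk : G → G ⧸ H))) (a b : G ⧸ H) :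
    d a b ≤ hausdorffPseudometric (d.comap QuotientGroup.mk) hd H a b := by
  have hfin := coset_hausdorffEDist_ne_top _ hd H a b
  let _ : PseudoMetricSpace G := (d.comap (QuotientGroup.mk : G → G ⧸ H)).toSpace
  obtain ⟨g, rfl⟩ := QuotientGroup.mk_surjective a
  obtain ⟨f, rfl⟩ := QuotientGroup.mk_surjective b
  refine le_trans ?_ (Metric.infDist_le_hausdorffDist_of_mem (x := g) rfl hfin)
  refine (Metric.le_infDist (s := (QuotientGroup.mk : G → G ⧸ H) ⁻¹' {(f : G ⧸ H)}) ⟨f, rfl⟩).2 fun y hy => ?_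
  have hy : (y : G ⧸ H) = f := hy
  change _ ≤ d (g : G ⧸ H) (y : G ⧸ H)
  rw [hy]

variable [TopologicalSpace G] [IsTopologicalGroup G]

theorem IsContinuousLeftInvariant.hausdorffPseudometric {d : PseudoMetric G ℝ}
    (hd : IsContinuousLeftInvariant d) :
    IsContinuousLeftInvariant (hausdorffPseudometric d hd.leftInvariant H) := by
  refine PseudoMetric.isContinuousLeftInvariant_of_eventually _
    (hausdorffPseudometric_leftInvariant H d hd.leftInvariant) fun ε hε => ?_
  have h1 : ∀ᶠ x in 𝓝 (1 : G), d 1 x < ε :=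
    hd.continuous_one.continuousAt.eventually_lt continuousAt_const (by simpa using hε)
  rw [← QuotientGroup.mk_one, QuotientGroup.nhds_eq, eventually_map]
  exact h1.mono fun x hx => (hausdorffPseudometric_mk_le H d hd.leftInvariant 1 x).trans_lt hx

/-- The left coarse structure of a quotient group is the Hausdorff-distance coarse structure. -/
theorem leftCoarse_quotient_eq_hausdorffCoarse : leftCoarse (G ⧸ H) = hausdorffCoarse H := by
  ext E
  refine mem_entourages_iInf_iff.trans (Iff.trans ?_ mem_entourages_iInf_iff.symm)
  constructor
  · rintro h ⟨d, hd⟩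
    exact h ⟨_, hd.hausdorffPseudometric H⟩
  · rintro h ⟨d, hd⟩
    obtain ⟨C, hC⟩ := h ⟨_, hd.comap (QuotientGroup.mk' H) QuotientGroup.continuous_mk⟩
    exact ⟨C, fun p hp => (le_hausdorffPseudometric_comap H d _ _ _).trans (hC p hp)⟩

omit [IsTopologicalGroup G] in
/-- If coarsely bounded sets lift along a quotient map of topological groups, then the quotient
coarse structure is the left coarse structure of the quotient group. -/
theorem quotient_leftCoarse_eq (hlift : ∀ A : Set (G ⧸ H), CoarselyBounded A →
      ∃ B : Set G, CoarselyBounded B ∧ A ⊆ (QuotientGroup.mk : G → G ⧸ H) '' B) :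
    (leftCoarse G).quotient (QuotientGroup.mk : G → G ⧸ H) = leftCoarse (G ⧸ H) := by
  ext E
  constructor
  · intro hE
    refine hE _ fun F hF => ?_
    rw [mem_leftCoarse_iff] at hF ⊢
    refine (hF.image (QuotientGroup.mk' H) QuotientGroup.continuous_mk).mono ?_
    rintro _ ⟨_, ⟨p, hp, rfl⟩, rfl⟩
    exact ⟨_, mem_image_of_mem _ hp, rfl⟩
  · intro hE 𝓕 h𝓕
    obtain ⟨B, hB, hAB⟩ := hlift _ (mem_leftCoarse_iff.1 hE)
    have hF : {p : G × G | p.1⁻¹ * p.2 ∈ B} ∈ (leftCoarse G).entourages := by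
      refine mem_leftCoarse_iff.2 (hB.mono ?_)
      rintro _ ⟨p, hp, rfl⟩
      exact hp
    refine 𝓕.mem_of_subset _ (h𝓕 _ hF) _ ?_
    rintro ⟨x, y⟩ hxy
    obtain ⟨b, hb, hbe⟩ := hAB (mem_image_of_mem _ hxy)
    obtain ⟨g, rfl⟩ := QuotientGroup.mk_surjective x
    refine ⟨(g, g * b), by simpa using hb, ?_⟩
    simp [Prod.map, hbe]

end Hausdorff

/-- Every compact subset of a quotient of a locally compact group is covered by the image of a
compact set. -/
theorem exists_isCompact_lift {L : Type*} [Group L] [TopologicalSpace L] [IsTopologicalGroup L]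
    [LocallyCompactSpace L] (M : Subgroup L) {K : Set (L ⧸ M)} (hK : IsCompact K) :
    ∃ C : Set L, IsCompact C ∧ K ⊆ (QuotientGroup.mk : L → L ⧸ M) '' C := by
  refine hK.induction_on ⟨∅, isCompact_empty, empty_subset _⟩
    (fun s t hst ⟨C, hC, h⟩ => ⟨C, hC, hst.trans h⟩)
    (fun s t ⟨C, hC, h⟩ ⟨D, hD, h'⟩ => ⟨C ∪ D, hC.union hD, ?_⟩) fun x _ => ?_
  · rw [image_union]
    exact union_subset_union h h'
  · obtain ⟨g, rfl⟩ := QuotientGroup.mk_surjective x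
    obtain ⟨C, hC, hCn⟩ := exists_compact_mem_nhds g
    exact ⟨_, mem_nhdsWithin_of_mem_nhds (QuotientGroup.isOpenMap_coe.image_mem_nhds hCn), C, hC,
      Subset.rfl⟩

/-- Let `f : G → L` be a homomorphism. If preimages of small sets are coarsely bounded in `G`
relative to a subgroup `H`, then so are preimages of compact sets. -/
theorem coarselyBounded_inter_preimage_of_isCompact {G L : Type*} [Group G] [TopologicalSpace G]
    [Group L] [TopologicalSpace L] [IsTopologicalGroup L] (H : Subgroup G) (f : G →* L)
    {V : Set L} (hV : V ∈ 𝓝 1) (hHV : CoarselyBounded ((H : Set G) ∩ f ⁻¹' V)) {K : Set L}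
    (hK : IsCompact K) : CoarselyBounded ((H : Set G) ∩ f ⁻¹' K) := by
  refine hK.induction_on (fun d _ => ⟨0, by simp⟩)
    (fun s t hst h => h.mono (inter_subset_inter_right _ (preimage_mono hst)))
    (fun s t hs ht d hd => ?_) fun x _ => ?_
  · obtain ⟨C, hC⟩ := hs d hd
    obtain ⟨D, hD⟩ := ht d hd
    refine ⟨max C D, ?_⟩
    rintro y ⟨hy, hy' | hy'⟩
    · exact (hC y ⟨hy, hy'⟩).trans (le_max_left _ _)
    · exact (hD y ⟨hy, hy'⟩).trans (le_max_right _ _)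
  · have hcont : Continuous fun p : L × L => p.1⁻¹ * p.2 := by fun_prop
    have hmem : (fun p : L × L => p.1⁻¹ * p.2) ⁻¹' V ∈ 𝓝 (x, x) :=
      hcont.continuousAt.preimage_mem_nhds (by simpa using hV)
    obtain ⟨W, hW, W', hW', hWV⟩ := mem_nhds_prod_iff.1 hmem
    refine ⟨W ∩ W', mem_nhdsWithin_of_mem_nhds (inter_mem hW hW'), fun d hd => ?_⟩
    obtain ⟨C, hC⟩ := hHV d hd
    -- A nonempty piece lies in one translate `h₀ * (H ∩ f ⁻¹' V)`, since quotients of elements of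
    -- `W ∩ W'` fall in `V`.
    rcases ((H : Set G) ∩ f ⁻¹' (W ∩ W')).eq_empty_or_nonempty with he | ⟨h₀, hh₀, hfh₀⟩
    · exact ⟨0, fun y hy => (he.subset hy).elim⟩
    · refine ⟨d 1 h₀ + C, fun h hh => (d.triangle 1 h₀ h).trans ?_⟩
      have h1 := hC (h₀⁻¹ * h) ⟨H.mul_mem (H.inv_mem hh₀) hh.1, by
        simpa using hWV (mk_mem_prod hfh₀.1 hh.2.2)⟩
      rw [← hd.leftInvariant h₀⁻¹ h₀ h, inv_mul_cancel]
      linarith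

end

/-! ### Products of sequences of groups -/

section

open Set Filter Topology Pointwise

variable {G : ℕ → Type*} [∀ n, Group (G n)]

/-- The projection of a product of a sequence of groups onto its first `k` factors. -/
def headHom (G : ℕ → Type*) [∀ n, Group (G n)] (k : ℕ) : (∀ n, G n) →* ∀ i : Fin k, G i where
  toFun x i := x i
  map_one' := rfl
  map_mul' _ _ := rfl

@[simp]
theorem headHom_apply (k : ℕ) (x : ∀ n, G n) (i : Fin k) : headHom G k x i = x i := rfl

theorem headHom_surjective (k : ℕ) : Function.Surjective (headHom G k) := fun y =>
  ⟨fun n => if h : n < k then y ⟨n, h⟩ else 1, funext fun i => by simp⟩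

variable [∀ n, TopologicalSpace (G n)]

theorem continuous_headHom (k : ℕ) : Continuous (headHom G k) :=
  continuous_pi fun _ => continuous_apply _

variable [∀ n, IsTopologicalGroup (G n)] [∀ n, LocallyCompactSpace (G n)]
  [∀ n, SigmaCompactSpace (G n)]

/-- If the coarse structure of a product of locally compact, `σ`-compact groups is metrisable on
a subgroup `H`, then coarse boundedness in `H` is detected by finitely many coordinates. -/
theorem exists_coarselyBounded_inter_preimage_headHom (H : Subgroup (∀ n, G n))
    (hH : ((leftCoarse (∀ n, G n)).restrict (H : Set (∀ n, G n))).Metrisable) :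
    ∃ N, ∀ K : Set (∀ i : Fin N, G i), IsCompact K →
      CoarselyBounded ((H : Set (∀ n, G n)) ∩ headHom G N ⁻¹' K) := by
  obtain ⟨ρ, -, hρ⟩ := hH
  have mem_iff : ∀ E : Set (H × H), Prod.map Subtype.val Subtype.val '' E ∈
      (leftCoarse (∀ n, G n)).entourages ↔ ∃ C, ∀ p ∈ E, ρ p.1 p.2 ≤ C := fun E =>
    Set.ext_iff.1 (congrArg CoarseStructure.entourages hρ) E
  choose V hV hVn using fun n => exists_compact_mem_nhds (1 : G n)
  -- Otherwise there are `h n` in `H`, in `V i` at each coordinate `i < n`, with `ρ 1 (h n) > n`.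
  -- Each coordinate leaves its `V i` only finitely often, so the sequence is coarsely bounded,
  -- hence `ρ`-bounded: a contradiction.
  obtain ⟨N, hN⟩ : ∃ N : ℕ, ∀ h : H, (∀ n < N, (h : ∀ n, G n) n ∈ V n) → ρ 1 h ≤ N := by
    by_contra! hcon
    choose h hhV hh using hcon
    obtain ⟨C, hC⟩ := (mem_iff (range fun n => (1, h n))).1 <| by
      rw [mem_leftCoarse_iff, coarselyBounded_pi_iff]
      intro i
      refine ⟨V i ∪ (fun n => (h n : ∀ n, G n) i) '' Iic i,
        (hV i).union ((finite_Iic i).image _).isCompact, ?_⟩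
      rintro _ ⟨_, ⟨_, ⟨n, rfl⟩, rfl⟩, rfl⟩
      rcases le_or_gt n i with hni | hni
      · exact Or.inr ⟨n, hni, by simp⟩
      · exact Or.inl (by simpa using hhV n i hni)
    obtain ⟨n, hn⟩ := exists_nat_ge C
    exact (hh n).not_ge ((hC _ ⟨n, rfl⟩).trans hn)
  refine ⟨N, fun K hK => coarselyBounded_inter_preimage_of_isCompact H (headHom G N)
    (V := univ.pi fun i : Fin N => V i) (set_pi_mem_nhds finite_univ fun i _ => hVn i) ?_ hK⟩
  have := (mem_iff {p | p.1 = 1 ∧ ρ 1 p.2 ≤ N}).2 ⟨N, by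
    rintro ⟨x, y⟩ ⟨hx, hy⟩
    obtain rfl : x = 1 := hx
    exact hy⟩
  refine (mem_leftCoarse_iff.1 this).mono ?_
  rintro h ⟨hh, hhV⟩
  refine ⟨_, ⟨(1, ⟨h, hh⟩), ⟨rfl, hN _ fun n hn => ?_⟩, rfl⟩, by simp⟩
  simpa using hhV ⟨n, hn⟩ trivial

variable (H : Subgroup (∀ n, G n)) [H.Normal]

/-- The projections of a coarsely bounded set of cosets to the first `k` coordinates can be
represented in a compact set. -/
theorem CoarselyBounded.exists_isCompact_headHom {A : Set ((∀ n, G n) ⧸ H)}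
    (hA : CoarselyBounded A) (k : ℕ) : ∃ C : Set (∀ i : Fin k, G i), IsCompact C ∧
      ∀ g : ∀ n, G n, (g : (∀ n, G n) ⧸ H) ∈ A → ∃ h ∈ H, headHom G k (g * h) ∈ C := by
  -- `M` need not be closed; local compactness and `σ`-compactness of the quotient suffice to
  -- enclose the image of `A` in a compact set.
  let M := H.map (headHom G k)
  have : M.Normal := Subgroup.Normal.map inferInstance _ (headHom_surjective k)
  have : SigmaCompactSpace ((∀ i : Fin k, G i) ⧸ M) := by
    rw [← isSigmaCompact_univ_iff, ← (QuotientGroup.mk_surjective (s := M)).range_eq]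
    exact isSigmaCompact_range QuotientGroup.continuous_mk
  let q : (∀ n, G n) ⧸ H →* (∀ i : Fin k, G i) ⧸ M :=
    QuotientGroup.map H M (headHom G k) (Subgroup.le_comap_map _ _)
  have hq : Continuous q :=
    (QuotientGroup.continuous_mk.comp (continuous_headHom k)).quotient_lift _
  obtain ⟨K, hK, hAK⟩ := (hA.image q hq).exists_isCompact
  obtain ⟨C, hC, hKC⟩ := exists_isCompact_lift M hK
  refine ⟨C, hC, fun g hg => ?_⟩
  obtain ⟨c, hc, hcg⟩ := hKC (hAK (mem_image_of_mem q hg))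
  have hcg : (headHom G k g : (∀ i : Fin k, G i) ⧸ M) = c := hcg.symm
  obtain ⟨h, hh, hhe⟩ := QuotientGroup.eq.1 hcg
  refine ⟨h, hh, ?_⟩
  rwa [map_mul, hhe, mul_inv_cancel_left]

/-- If the coarse structure of the product is metrisable on `H`, then coarsely bounded subsets of
the quotient by `H` lift to coarsely bounded sets. -/
theorem CoarselyBounded.exists_lift
    (hH : ((leftCoarse (∀ n, G n)).restrict (H : Set (∀ n, G n))).Metrisable)
    {A : Set ((∀ n, G n) ⧸ H)} (hA : CoarselyBounded A) :
    ∃ B : Set (∀ n, G n), CoarselyBounded B ∧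
      A ⊆ (QuotientGroup.mk : (∀ n, G n) → (∀ n, G n) ⧸ H) '' B := by
  obtain ⟨N, hN⟩ := exists_coarselyBounded_inter_preimage_headHom H hH
  choose C hC hAC using hA.exists_isCompact_headHom H
  -- Only the first `N` coordinates are constrained, by one compact set.
  refine ⟨{g | (g : (∀ n, G n) ⧸ H) ∈ A ∧ headHom G N g ∈ C N}, ?_, fun a ha => ?_⟩
  · refine coarselyBounded_pi_iff.2 fun i => ?_
    let k := max N (i + 1)
    have hNk : N ≤ k := le_max_left _ _
    have hik : i < k := Nat.lt_of_succ_le (le_max_right _ _)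
    let r : (∀ j : Fin k, G j) → ∀ j : Fin N, G j := fun x j => x (Fin.castLE hNk j)
    have hr : Continuous r := continuous_pi fun j => continuous_apply (Fin.castLE hNk j)
    obtain ⟨K, hK, hHK⟩ := coarselyBounded_pi_iff.1 (hN _ ((hC N).inv.mul ((hC k).image hr))) i
    -- With `g * h` in `C k` on the first `k` coordinates, the first `N` coordinates of `h = g⁻¹ *
    -- (g * h)` lie in a compact set independent of `g`. The choice of `N` then puts `h i` in `K`,
    -- and `g i = (g * h) i * (h i)⁻¹`.
    refine ⟨_, ((hC k).image (continuous_apply (⟨i, hik⟩ : Fin k))).mul hK.inv, ?_⟩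
    rintro g ⟨hgA, hgC⟩
    obtain ⟨h, hh, hghC⟩ := hAC k g hgA
    refine ⟨_, mem_image_of_mem _ hghC, (h i)⁻¹, Set.inv_mem_inv.2 (hHK h ⟨hh, ?_⟩), ?_⟩
    · refine ⟨_, Set.inv_mem_inv.2 hgC, _, mem_image_of_mem r hghC, ?_⟩
      ext j
      simp [r]
    · simp
  · obtain ⟨g, rfl⟩ := QuotientGroup.mk_surjective a
    obtain ⟨h, hh, hghC⟩ := hAC N g ha
    have hgh : ((g * h : ∀ n, G n) : (∀ n, G n) ⧸ H) = g := QuotientGroup.mk_mul_of_mem g hh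
    exact ⟨g * h, ⟨by rwa [hgh], hghC⟩, hgh⟩

end

theorem mainTheorem4 (G : ℕ → Type*) [∀ n, Group (G n)] [∀ n, TopologicalSpace (G n)]
    [∀ n, IsTopologicalGroup (G n)] [∀ n, LocallyCompactSpace (G n)]
    [∀ n, SigmaCompactSpace (G n)] (H : Subgroup (∀ n, G n)) [H.Normal]
    (hclosed : IsClosed (H : Set (∀ n, G n)))
    (hmetrisable : ((leftCoarse (∀ n, G n)).restrict (H : Set (∀ n, G n))).Metrisable) :
    (leftCoarse (∀ n, G n)).quotient (QuotientGroup.mk : (∀ n, G n) → (∀ n, G n) ⧸ H)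
        = leftCoarse ((∀ n, G n) ⧸ H) ∧
      leftCoarse ((∀ n, G n) ⧸ H) = hausdorffCoarse H :=
  ⟨quotient_leftCoarse_eq H fun _ hA => hA.exists_lift H hmetrisable,
    leftCoarse_quotient_eq_hausdorffCoarse H⟩
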